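/- Conventions. Everything is smooth ($C^\infty$). A spacetime $(X^{m+1},g)$ is a time-oriented Lorentz manifold of dimension $m+1$, and here $m>1$. $J^\pm(x)$ are the causal future and past of $x$ (with $x\in J^\pm(x)$); $x,y$ are causally related if $y\in J^+(x)$ or $x\in J^+(y)$. A spacetime without closed causal curves is causally simple if all the sets $J^\pm(x)$ are closed, and globally hyperbolic if all the sets $J^+(x)\cap J^-(y)$ are compact. $\mathcal N_X$ is the space of light rays (inextendible unparametrized future-directed null geodesics) of $X$, with its canonical (possibly non-Hausdorff) smooth structure, for which the projection from the bundle of future-directed null vectors is a submersion, and with its canonical contact structure, which is induced by the kernel of the form $\xi\mapsto g(v,d\pi\,\xi)$ at a null vector $v$, where $\pi$ is the projection of the bundle of null vectors to $X$. The sky $\mathfrak S_x\subset\mathcal N_X$ of $x$ is the set of the light rays through $x$. Two two-component Legendrian links in $\mathcal N_X$ are Legendrian isotopic if they are joined by a smooth family $(f_t,g_t)_{t\in[0,1]}$ of pairs of Legendrian embeddings $S^{m-1}\to\mathcal N_X$ with disjoint images. A strongly causal spacetime is refocussing if it has a point $x$ with a neighbourhood $V$ such that for every open $U$ with $x\in U\subset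 V$ there is a $y\notin U$ such that all null geodesics through $y$ enter $U$. Theorem. Let $(X^{m+1},g)$, $m>1$, be a causally simple spacetime, let $(\widetilde X,\widetilde g)$ be a globally hyperbolic spacetime of the same dimension, and let $\Phi:X\to\widetilde X$ be a conformal, time-orientation-preserving embedding onto an open subset. Assume that (0) $\mathcal N_X$ is an open contact submanifold of $\mathcal N_{\widetilde X}$: the map $\mathcal N_X\to\mathcal N_{\widetilde X}$ that sends the light ray tangent to $v$ to the light ray tangent to $d\Phi(v)$ is a diffeomorphism onto an open subset and respects the contact structures; (1) for any two causally related points $p,q\in\widetilde X$ the link $(\mathfrak S_p,\mathfrak S_q)$ is not Legendrian isotopic in $\mathcal N_{\widetilde X}$ to the unlink, that is, to a link $(\mathfrak S_{p'},\mathfrak S_{q'})$ formed by the skies of causally unrelated points $p',q'\in\widetilde X$; (2) if $x,y\in X$ are causally unrelated in $X$, then $\Phi(x),\Phi(y)$ are causally unrelated in $\widetilde X$. Then the Legendrian Low conjecture holds for $(X,g)$: if the manifold $X$ does not admit a time-oriented Lorentz metric $g'$ such that $(X,g')$ is causally simple and refocussing, then for all causally related $x,y\in X$ that do not lie on a common null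 geodesic and all causally unrelated $\hat x,\hat y\in X$, the Legendrian links $(\mathfrak S_x,\mathfrak S_y)$ and $(\mathfrak S_{\hat x},\mathfrak S_{\hat y})$ are not Legendrian isotopic in $\mathcal N_X$. -/

import Mathlib

open Set Filter Topology Manifold ContDiff

noncomputable section

/-- The standard `n`-dimensional sphere, the model of a sky in a spacetime of dimension `n + 2`. -/
abbrev StdSphere (n : ℕ) : Type := Metric.sphere (0 : EuclideanSpace ℝ (Fin (n + 1))) 1

/-- A time-oriented smooth Lorentz metric, of signature `(-, +, ..., +)`, on a smooth manifold `X`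
of dimension `d`. The time orientation is given by a smooth timelike vector field, which selects at
every point the half of the causal cone that is called the future. -/
structure Spacetime (d : ℕ) (X : Type*) [TopologicalSpace X]
    [ChartedSpace (EuclideanSpace ℝ (Fin d)) X] [IsManifold (𝓡 d) ∞ X] where
  /-- The metric tensor. -/
  metric (x : X) : TangentSpace (𝓡 d) x →L[ℝ] TangentSpace (𝓡 d) x →L[ℝ] ℝ
  metric_symm (x : X) (v w : TangentSpace (𝓡 d) x) : metric x v w = metric x w v
  /-- Lorentz signature: there is a negative vector whose orthogonal complement is positive
  definite. -/
  metric_lorentz (x : X) : ∃ u : TangentSpace (𝓡 d) x, metric x u u < 0 ∧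
    ∀ w : TangentSpace (𝓡 d) x, metric x u w = 0 → w ≠ 0 → 0 < metric x w w
  metric_smooth : ContMDiff (𝓡 d)
    ((𝓡 d).prod 𝓘(ℝ, EuclideanSpace ℝ (Fin d) →L[ℝ] EuclideanSpace ℝ (Fin d) →L[ℝ] ℝ)) ∞
    (fun x ↦ Bundle.TotalSpace.mk'
      (EuclideanSpace ℝ (Fin d) →L[ℝ] EuclideanSpace ℝ (Fin d) →L[ℝ] ℝ)
      (E := fun x : X ↦ TangentSpace (𝓡 d) x →L[ℝ] TangentSpace (𝓡 d) x →L[ℝ] ℝ) x (metric x))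
  /-- The vector field that gives the time orientation. -/
  timeField (x : X) : TangentSpace (𝓡 d) x
  timeField_smooth : ContMDiff (𝓡 d) (𝓡 d).tangent ∞
    (fun x ↦ (⟨x, timeField x⟩ : TangentBundle (𝓡 d) X))
  timeField_timelike (x : X) : metric x (timeField x) (timeField x) < 0

namespace Spacetime

variable {d : ℕ} {X : Type*} [TopologicalSpace X]
  [ChartedSpace (EuclideanSpace ℝ (Fin d)) X] [IsManifold (𝓡 d) ∞ X]

/-! ### Causality -/

/-- `v` is a future-directed causal (timelike or null, nonzero) vector. -/
def IsFutureCausal (S : Spacetime d X) (v : TangentBundle (𝓡 d) X) : Prop :=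
  v.2 ≠ 0 ∧ S.metric v.1 v.2 v.2 ≤ 0 ∧ S.metric v.1 v.2 (S.timeField v.1) < 0

/-- There is a smooth future-directed causal curve `[0, 1] → X` from `x` to `y`. -/
def CausalStep (S : Spacetime d X) (x y : X) : Prop :=
  ∃ γ : ℝ → X, ContMDiffOn 𝓘(ℝ, ℝ) (𝓡 d) ∞ γ (Icc 0 1) ∧ γ 0 = x ∧ γ 1 = y ∧
    ∀ t ∈ Icc (0 : ℝ) 1,
      S.IsFutureCausal ⟨γ t, mfderivWithin 𝓘(ℝ, ℝ) (𝓡 d) γ (Icc 0 1) t (1 : ℝ)⟩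

/-- The causal future `J⁺(x)`: `x` itself and the end points of all piecewise smooth
future-directed causal curves that start at `x`. -/
def causalFuture (S : Spacetime d X) (x : X) : Set X := {y | Relation.ReflTransGen S.CausalStep x y}

/-- The causal past `J⁻(x)`. -/
def causalPast (S : Spacetime d X) (x : X) : Set X := {y | Relation.ReflTransGen S.CausalStep y x}

/-- Two events are causally related if one of them lies in the causal future of the other. -/
def CausallyRelated (S : Spacetime d X) (x y : X) : Prop :=
  y ∈ S.causalFuture x ∨ x ∈ S.causalFuture y

/-- There is no closed piecewise smooth future-directed causal curve. -/
def IsCausal (S : Spacetime d X) : Prop := ∀ x, ¬ Relation.TransGen S.CausalStep x x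

/-- Causal, and all the sets `J⁺(x)` and `J⁻(x)` are closed. -/
def IsCausallySimple (S : Spacetime d X) : Prop :=
  S.IsCausal ∧ ∀ x, IsClosed (S.causalFuture x) ∧ IsClosed (S.causalPast x)

/-- Causal, and all the sets `J⁺(x) ∩ J⁻(y)` are compact. -/
def IsGloballyHyperbolic (S : Spacetime d X) : Prop :=
  S.IsCausal ∧ ∀ x y, IsCompact (S.causalFuture x ∩ S.causalPast y)

/-- Strong causality: every neighbourhood `U` of a point contains a neighbourhood `V` such that
every causal curve with end points in `V` stays in `U`. (The points of the causal curves from `p`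
to `q` are exactly the points of `J⁺(p) ∩ J⁻(q)`.) -/
def IsStronglyCausal (S : Spacetime d X) : Prop :=
  ∀ x, ∀ U ∈ 𝓝 x, ∃ V ∈ 𝓝 x, V ⊆ U ∧ ∀ p ∈ V, ∀ q ∈ V, S.causalFuture p ∩ S.causalPast q ⊆ U

/-! ### Geodesics -/

/-- The coefficients `g(u, w)` of the metric in the preferred chart at `x₀`, as functions of the
coordinates `y`, for constant coordinate vectors `u`, `w`. -/
def chartMetric (S : Spacetime d X) (x₀ : X) (y u w : EuclideanSpace ℝ (Fin d)) : ℝ :=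
  S.metric ((extChartAt (𝓡 d) x₀).symm y)
    (mfderiv 𝓘(ℝ, EuclideanSpace ℝ (Fin d)) (𝓡 d) (extChartAt (𝓡 d) x₀).symm y u)
    (mfderiv 𝓘(ℝ, EuclideanSpace ℝ (Fin d)) (𝓡 d) (extChartAt (𝓡 d) x₀).symm y w)

/-- The Christoffel symbol of the first kind `Γ(u, u; w) = g(∇_u u, w)` of the Levi-Civita
connection, for constant coordinate vectors `u`, `w`:
`∂_u g(u, w) - (1/2) ∂_w g(u, u)`. -/
def christoffel (S : Spacetime d X) (x₀ : X) (y u w : EuclideanSpace ℝ (Fin d)) : ℝ :=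
  fderiv ℝ (fun z ↦ S.chartMetric x₀ z u w) y u
    - (1 / 2) * fderiv ℝ (fun z ↦ S.chartMetric x₀ z u u) y w

/-- The geodesic equation `∇_γ' γ' = 0` at time `t`, written in the preferred chart at `γ t`:
`g(x'', w) + Γ(x', x'; w) = 0` for all `w`. -/
def GeodesicEquationAt (S : Spacetime d X) (γ : ℝ → X) (t : ℝ) : Prop :=
  let x : ℝ → EuclideanSpace ℝ (Fin d) := fun s ↦ extChartAt (𝓡 d) (γ t) (γ s)
  ∀ w : EuclideanSpace ℝ (Fin d),
    S.chartMetric (γ t) (x t) (deriv (deriv x) t) w + S.christoffel (γ t) (x t) (deriv x t) w = 0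

/-- `γ` restricts to an (affinely parametrized) geodesic on the interval `(a, b)`. -/
def IsGeodesicOn (S : Spacetime d X) (γ : ℝ → X) (a b : ℝ) : Prop :=
  ContMDiffOn 𝓘(ℝ, ℝ) (𝓡 d) ∞ γ (Ioo a b) ∧ ∀ t ∈ Ioo a b, S.GeodesicEquationAt γ t

/-! ### The space of light rays -/

/-- The bundle of future-directed null vectors, as a subset of the tangent bundle. -/
def nullCone (S : Spacetime d X) : Set (TangentBundle (𝓡 d) X) :=
  {v | S.metric v.1 v.2 v.2 = 0 ∧ S.IsFutureCausal v}

/-- Two future-directed null vectors are tangent to one unparametrized null geodesic: some geodesic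
has the velocity `v` at one time, and a positive multiple of `w` as its velocity at another. -/
def SameLightRay (S : Spacetime d X) (v w : S.nullCone) : Prop :=
  ∃ (γ : ℝ → X) (a b s t c : ℝ), s ∈ Ioo a b ∧ t ∈ Ioo a b ∧ 0 < c ∧ S.IsGeodesicOn γ a b ∧
    (⟨γ s, mfderiv 𝓘(ℝ, ℝ) (𝓡 d) γ s (1 : ℝ)⟩ : TangentBundle (𝓡 d) X) = v.1 ∧
    (⟨γ t, mfderiv 𝓘(ℝ, ℝ) (𝓡 d) γ t (1 : ℝ)⟩ : TangentBundle (𝓡 d) X) = ⟨w.1.1, c • w.1.2⟩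

/-- The space of light rays, that is of inextendible unparametrized future-directed null geodesics:
a light ray is the class of all its future-directed tangent vectors. -/
def LightRay (S : Spacetime d X) : Type _ := Quot S.SameLightRay

/-- The light ray to which a future-directed null vector is tangent. -/
def ray (S : Spacetime d X) (v : S.nullCone) : S.LightRay := Quot.mk _ v

/-- The space of light rays carries the quotient topology. -/
instance (S : Spacetime d X) : TopologicalSpace S.LightRay :=
  inferInstanceAs (TopologicalSpace (Quot S.SameLightRay))

/-- The sky of `x`: the set of all light rays through `x`. -/
def sky (S : Spacetime d X) (x : X) : Set S.LightRay := {ℓ | ∃ v : S.nullCone, v.1.1 = x ∧ S.ray v = ℓ}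

/-- The spacetime is (weakly) refocussing at `x`: there is a neighbourhood `V` of `x` such that for
every open `U` with `x ∈ U ⊆ V` there is a point `y ∉ U` all light rays through which enter `U`. -/
def IsRefocussingAt (S : Spacetime d X) (x : X) : Prop :=
  ∃ V ∈ 𝓝 x, ∀ U : Set X, IsOpen U → x ∈ U → U ⊆ V →
    ∃ y ∉ U, ∀ ℓ ∈ S.sky y, ∃ z ∈ U, ℓ ∈ S.sky z

/-- Refocussing (strongly causal) spacetimes. -/
def IsRefocussing (S : Spacetime d X) : Prop := S.IsStronglyCausal ∧ ∃ x, S.IsRefocussingAt x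

/-! ### The smooth structure and the contact structure of the space of light rays

The smooth structure is the one for which the projection of the null cone bundle `nullCone` to the
space of light rays is a submersion: functions on the space of light rays are smooth if their
pull-backs to the null cone bundle are, and maps into it are smooth if they lift locally to smooth
maps into the null cone bundle. -/

/-- A real function is smooth on the (open) set `W` of light rays. -/
def SmoothFunOn (S : Spacetime d X) (h : S.LightRay → ℝ) (W : Set S.LightRay) : Prop :=
  ∃ H : TangentBundle (𝓡 d) X → ℝ,
    ContMDiffOn (𝓡 d).tangent 𝓘(ℝ, ℝ) ∞ H (Subtype.val '' (S.ray ⁻¹' W)) ∧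
    ∀ v : S.nullCone, S.ray v ∈ W → H v.1 = h (S.ray v)

section Maps

variable {F : Type*} [NormedAddCommGroup F] [NormedSpace ℝ F] {H : Type*} [TopologicalSpace H]
  (J : ModelWithCorners ℝ F H) {M : Type*} [TopologicalSpace M] [ChartedSpace H M]

/-- `L` is a smooth lift on the set `U` of the map `f` to the null cone bundle. -/
def IsLiftOn (S : Spacetime d X) (f : M → S.LightRay) (L : M → TangentBundle (𝓡 d) X)
    (U : Set M) : Prop :=
  ContMDiffOn J (𝓡 d).tangent ∞ L U ∧ ∀ q ∈ U, ∃ hq : L q ∈ S.nullCone, S.ray ⟨L q, hq⟩ = f q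

/-- A map from a manifold to the space of light rays is smooth on the set `s`. -/
def SmoothMapOn (S : Spacetime d X) (f : M → S.LightRay) (s : Set M) : Prop :=
  ∀ p ∈ s, ∃ U ∈ 𝓝[s] p, ∃ L, S.IsLiftOn J f L U

/-- The differential at `p` of a map to the space of light rays takes its values in the contact
distribution. The contact distribution is the image of the kernel of the canonical 1-form
`ξ ↦ g(v, dπ ξ)` at `v` on the null cone bundle, where `π` is the projection to the spacetime;
the kernel of the canonical form contains the tangent spaces of the fibres of the
projection to light rays, so the condition can be read off from any local lift `L`. -/
def TangentToContactAt (S : Spacetime d X) (f : M → S.LightRay) (p : M) : Prop :=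
  ∃ U ∈ 𝓝 p, ∃ L, S.IsLiftOn J f L U ∧
    ∀ ξ : TangentSpace J p, S.metric (L p).1 (L p).2 (mfderiv J (𝓡 d) (fun q ↦ (L q).1) p ξ) = 0

/-- The differential at `p` of a map to the space of light rays is injective: every nonzero tangent
vector is detected by a smooth function that is defined near `f p`. -/
def ImmersiveAt (S : Spacetime d X) (f : M → S.LightRay) (p : M) : Prop :=
  ∀ ξ : TangentSpace J p, ξ ≠ 0 → ∃ (W : Set S.LightRay) (h : S.LightRay → ℝ),
    IsOpen W ∧ f p ∈ W ∧ S.SmoothFunOn h W ∧ mfderiv J 𝓘(ℝ, ℝ) (h ∘ f) p ξ ≠ 0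

end Maps

end Spacetime

/-! ### Legendrian links -/

namespace Spacetime

variable {n : ℕ} {X : Type*} [TopologicalSpace X]
  [ChartedSpace (EuclideanSpace ℝ (Fin (n + 2))) X] [IsManifold (𝓡 (n + 2)) ∞ X]

/-- A Legendrian embedding of the `n`-sphere into the `(2 n + 1)`-dimensional space of light rays of
a spacetime of dimension `n + 2`. -/
structure IsLegendrianEmbedding (S : Spacetime (n + 2) X) (f : StdSphere n → S.LightRay) :
    Prop where
  smooth : S.SmoothMapOn (𝓡 n) f univ
  immersive : ∀ p, S.ImmersiveAt (𝓡 n) f p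
  isEmbedding : IsEmbedding f
  tangent : ∀ p, S.TangentToContactAt (𝓡 n) f p

/-- The two-component links `(A₀, B₀)` and `(A₁, B₁)` of Legendrian spheres in the space of light
rays are Legendrian isotopic: there are smooth families `f t`, `g t`, `t ∈ [0, 1]`, of Legendrian
embeddings of the sphere, with disjoint images for every `t`, that parametrize the first link for
`t = 0` and the second one for `t = 1`. -/
def LegendrianIsotopic (S : Spacetime (n + 2) X) (A₀ B₀ A₁ B₁ : Set S.LightRay) : Prop :=
  ∃ f g : ℝ → StdSphere n → S.LightRay,
    S.SmoothMapOn (𝓘(ℝ, ℝ).prod (𝓡 n)) (fun p : ℝ × StdSphere n ↦ f p.1 p.2) (Icc 0 1 ×ˢ univ) ∧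
    S.SmoothMapOn (𝓘(ℝ, ℝ).prod (𝓡 n)) (fun p : ℝ × StdSphere n ↦ g p.1 p.2) (Icc 0 1 ×ˢ univ) ∧
    (∀ t ∈ Icc (0 : ℝ) 1, S.IsLegendrianEmbedding (f t) ∧ S.IsLegendrianEmbedding (g t) ∧
      Disjoint (range (f t)) (range (g t))) ∧
    range (f 0) = A₀ ∧ range (g 0) = B₀ ∧ range (f 1) = A₁ ∧ range (g 1) = B₁

/-- The link `(A, B)` is Legendrian isotopic to the unlink, that is to the link formed by the skies
of two causally unrelated events. (In a connected globally hyperbolic spacetime all such links are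
Legendrian isotopic.) -/
def IsotopicToUnlink (S : Spacetime (n + 2) X) (A B : Set S.LightRay) : Prop :=
  ∃ p q, ¬ S.CausallyRelated p q ∧ S.LegendrianIsotopic A B (S.sky p) (S.sky q)

end Spacetime

/-! ### Conformal embeddings -/

section Conformal

variable {d : ℕ} {X : Type*} [TopologicalSpace X]
  [ChartedSpace (EuclideanSpace ℝ (Fin d)) X] [IsManifold (𝓡 d) ∞ X]
  {Y : Type*} [TopologicalSpace Y]
  [ChartedSpace (EuclideanSpace ℝ (Fin d)) Y] [IsManifold (𝓡 d) ∞ Y]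

/-- `Φ` is a conformal embedding of a spacetime onto an open subset of another spacetime of the same
dimension, and preserves the time orientation. (The differential of `Φ` is bijective, because
of the conformality.) -/
structure IsConformalOpenEmbedding (S : Spacetime d X) (T : Spacetime d Y) (Φ : X → Y) : Prop where
  smooth : ContMDiff (𝓡 d) (𝓡 d) ∞ Φ
  isOpenEmbedding : IsOpenEmbedding Φ
  conformal : ∃ Ω : X → ℝ, ContMDiff (𝓡 d) 𝓘(ℝ, ℝ) ∞ Ω ∧ (∀ x, 0 < Ω x) ∧
    ∀ (x : X) (v w : TangentSpace (𝓡 d) x),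
      T.metric (Φ x) (mfderiv (𝓡 d) (𝓡 d) Φ x v) (mfderiv (𝓡 d) (𝓡 d) Φ x w)
        = Ω x * S.metric x v w
  future : ∀ v : TangentBundle (𝓡 d) X,
    S.IsFutureCausal v → T.IsFutureCausal (tangentMap (𝓡 d) (𝓡 d) Φ v)

/-- The differential of a conformal embedding maps null cones to null cones. -/
theorem IsConformalOpenEmbedding.mem_nullCone {S : Spacetime d X} {T : Spacetime d Y} {Φ : X → Y}
    (hΦ : IsConformalOpenEmbedding S T Φ) (v : S.nullCone) :
    tangentMap (𝓡 d) (𝓡 d) Φ v.1 ∈ T.nullCone := by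
  obtain ⟨Ω, -, -, h⟩ := hΦ.conformal
  refine ⟨?_, hΦ.future v.1 v.2.2⟩
  have h1 := h v.1.1 v.1.2 v.1.2
  rw [v.2.1, mul_zero] at h1
  exact h1

/-- `ι` identifies the space of light rays of one spacetime with an open contact submanifold of the
space of light rays of another: it is a diffeomorphism onto an open subset, and its differential
matches the contact distributions (tested on smooth curves). -/
structure IsOpenContactEmbedding (S : Spacetime d X) (T : Spacetime d Y)
    (ι : S.LightRay → T.LightRay) : Prop where
  isOpenEmbedding : IsOpenEmbedding ι
  smooth_iff : ∀ (W : Set S.LightRay) (h : T.LightRay → ℝ), IsOpen W →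
    (T.SmoothFunOn h (ι '' W) ↔ S.SmoothFunOn (h ∘ ι) W)
  contact_iff : ∀ c : ℝ → S.LightRay, S.SmoothMapOn 𝓘(ℝ, ℝ) c univ → ∀ t,
    (S.TangentToContactAt 𝓘(ℝ, ℝ) c t ↔ T.TangentToContactAt 𝓘(ℝ, ℝ) (ι ∘ c) t)

/-- By means of the conformal embedding `Φ`, the space of light rays of the first spacetime is an
open contact submanifold of that of the second one: the map that sends the light ray tangent to `v`
to the light ray tangent to `dΦ(v)` is an open contact embedding. -/
def IsOpenContactSubmanifold {S : Spacetime d X} {T : Spacetime d Y} {Φ : X → Y}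
    (hΦ : IsConformalOpenEmbedding S T Φ) : Prop :=
  ∃ ι : S.LightRay → T.LightRay,
    (∀ v : S.nullCone, ι (S.ray v) = T.ray ⟨tangentMap (𝓡 d) (𝓡 d) Φ v.1, hΦ.mem_nullCone v⟩) ∧
    IsOpenContactEmbedding S T ι

end Conformal

end

/-! A conformal factor changes neither null cones nor the kernel of the canonical form `ξ ↦ g(v, dπ
ξ)`, so the whole configuration can be carried from `X` to the globally hyperbolic target. The map
`ι` of light rays sends skies onto skies (`image_sky`) and Legendrian isotopies to Legendrian
isotopies (`legendrianIsotopic_map`), while causal curves map to causal curves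
(`causallyRelated_map`). An isotopy in `X` from the link of causally related events to that of
unrelated ones would thus give an isotopy of the same kind in the target: the images of the
unrelated events are still unrelated by (2), and this is what (1) forbids. -/

section Pushforward

variable {d : ℕ} {X : Type*} [TopologicalSpace X]
  [ChartedSpace (EuclideanSpace ℝ (Fin d)) X] [IsManifold (𝓡 d) ∞ X]
  {Y : Type*} [TopologicalSpace Y]
  [ChartedSpace (EuclideanSpace ℝ (Fin d)) Y] [IsManifold (𝓡 d) ∞ Y]
  {S : Spacetime d X} {T : Spacetime d Y} {Φ : X → Y}

/-- A Lorentz metric is nondegenerate. -/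
theorem Spacetime.eq_zero_of_metric_eq_zero (S : Spacetime d X) {x : X}
    {v : TangentSpace (𝓡 d) x} (h : ∀ w, S.metric x w v = 0) : v = 0 := by
  obtain ⟨u, -, hu⟩ := S.metric_lorentz x
  by_contra hv
  exact (hu v (h u) hv).ne' (h v)

/-! ### Null vectors and causal curves under a conformal embedding. -/

namespace IsConformalOpenEmbedding

theorem mdifferentiable (hΦ : IsConformalOpenEmbedding S T Φ) :
    MDifferentiable (𝓡 d) (𝓡 d) Φ :=
  hΦ.smooth.mdifferentiable (by simp)

/-- A vector killed by the differential lies in the radical of `Ω g`, which is trivial. -/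
theorem mfderiv_injective (hΦ : IsConformalOpenEmbedding S T Φ) (x : X) :
    Function.Injective (mfderiv (𝓡 d) (𝓡 d) Φ x) := by
  obtain ⟨Ω, -, hpos, h⟩ := hΦ.conformal
  refine (injective_iff_map_eq_zero _).2 fun v hv ↦ S.eq_zero_of_metric_eq_zero fun w ↦ ?_
  have h1 := h x w v
  rw [hv, map_zero] at h1
  exact (mul_eq_zero.1 h1.symm).resolve_left (hpos x).ne'

theorem mfderiv_surjective (hΦ : IsConformalOpenEmbedding S T Φ) (x : X) :
    Function.Surjective (mfderiv (𝓡 d) (𝓡 d) Φ x) := by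
  let A : EuclideanSpace ℝ (Fin d) →L[ℝ] EuclideanSpace ℝ (Fin d) := mfderiv (𝓡 d) (𝓡 d) Φ x
  have hA : Function.Injective A.toLinearMap := hΦ.mfderiv_injective x
  have hA' : Function.Surjective A.toLinearMap := LinearMap.injective_iff_surjective.1 hA
  exact hA'

/-- A vector whose image is future-directed null is itself future-directed null. -/
theorem mem_nullCone_of_map (hΦ : IsConformalOpenEmbedding S T Φ) {v : TangentBundle (𝓡 d) X}
    (hv : tangentMap (𝓡 d) (𝓡 d) Φ v ∈ T.nullCone) : v ∈ S.nullCone := by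
  obtain ⟨Ω, -, hpos, h⟩ := hΦ.conformal
  obtain ⟨x, v⟩ := v
  obtain ⟨hnull, hne, -, hfut⟩ := hv
  have hv0 : S.metric x v v = 0 :=
    (mul_eq_zero.1 ((h x v v).symm.trans hnull)).resolve_left (hpos x).ne'
  refine ⟨hv0, fun h0 : v = 0 ↦ hne ?_, hv0.le, ?_⟩
  · subst h0
    exact map_zero (mfderiv (𝓡 d) (𝓡 d) Φ x)
  -- Only the sign of `g(v, τ)` is left, and `future` says nothing about `v` until `v` is known to
  -- be future-directed. If `v` were past-directed, both `-v` and `v` would have future-directed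
  -- images, up to the perturbation by `ε τ`.
  by_contra hcon
  have hcon : 0 ≤ S.metric x v (S.timeField x) := not_lt.1 hcon
  have hτ := S.timeField_timelike x
  set τ := S.timeField x with hτ_def
  set D := mfderiv (𝓡 d) (𝓡 d) Φ x with hD
  set a := T.metric (Φ x) (D v) (T.timeField (Φ x)) with ha
  set b := T.metric (Φ x) (D τ) (T.timeField (Φ x)) with hb
  have hfut : a < 0 := hfut
  -- Otherwise `-v + ε τ` would be future-directed causal for all `ε > 0`.
  have key : ∀ ε : ℝ, 0 < ε → -a + ε * b < 0 := by
    intro ε hε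
    have h1 : S.metric x (-v + ε • τ) τ < 0 := by
      simp only [map_add, map_neg, map_smul, _root_.add_apply,
        _root_.neg_apply, _root_.smul_apply, smul_eq_mul]
      nlinarith [mul_neg_of_pos_of_neg hε hτ]
    have h2 : S.metric x (-v + ε • τ) (-v + ε • τ) ≤ 0 := by
      simp only [map_add, map_neg, map_smul, _root_.add_apply,
        _root_.neg_apply, _root_.smul_apply, smul_eq_mul,
        S.metric_symm x τ v, hv0]
      nlinarith [mul_neg_of_pos_of_neg (mul_pos hε hε) hτ, mul_nonneg hε.le hcon]
    have h3 : -v + ε • τ ≠ 0 := by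
      intro h0
      rw [h0, map_zero] at h1
      exact lt_irrefl _ h1
    have h4 := (hΦ.future ⟨x, -v + ε • τ⟩ ⟨h3, h2, h1⟩).2.2
    change T.metric (Φ x) (D (-v + ε • τ)) (T.timeField (Φ x)) < 0 at h4
    simpa only [map_add, map_neg, map_smul, _root_.add_apply,
      _root_.neg_apply, _root_.smul_apply, smul_eq_mul] using h4
  -- With `ε = -a / (|b| + 1)` one gets `-a + ε b ≥ ε (|b| + 1) - ε |b| = ε > 0`, against `key`.
  have h1 : 0 < |b| + 1 := by positivity
  have h2 := key (-a / (|b| + 1)) (div_pos (neg_pos.2 hfut) h1)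
  have h3 : -a / (|b| + 1) * (|b| + 1) = -a := div_mul_cancel₀ _ h1.ne'
  nlinarith [div_pos (neg_pos.2 hfut) h1, neg_abs_le b]

theorem causalStep_map (hΦ : IsConformalOpenEmbedding S T Φ) {x y : X}
    (h : S.CausalStep x y) : T.CausalStep (Φ x) (Φ y) := by
  obtain ⟨γ, hγ, h0, h1, hc⟩ := h
  refine ⟨Φ ∘ γ, hΦ.smooth.comp_contMDiffOn hγ, congrArg Φ h0, congrArg Φ h1, fun t ht ↦ ?_⟩
  -- Unique differentiability makes the chain rule for one-sided derivatives valid at the end points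
  -- too.
  have hu : UniqueMDiffWithinAt 𝓘(ℝ, ℝ) (Icc (0 : ℝ) 1) t :=
    ((uniqueDiffOn_Icc zero_lt_one) t ht).uniqueMDiffWithinAt
  have hd : MDifferentiableWithinAt 𝓘(ℝ, ℝ) (𝓡 d) γ (Icc 0 1) t :=
    (hγ t ht).mdifferentiableWithinAt (by simp)
  have key := hΦ.future _ (hc t ht)
  rw [mfderiv_comp_mfderivWithin t (hΦ.mdifferentiable (γ t)) hd hu]
  exact key

/-- Only this direction is automatic: a causal curve between image points may leave the image of
`Φ`. -/
theorem causallyRelated_map (hΦ : IsConformalOpenEmbedding S T Φ) {x y : X}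
    (h : S.CausallyRelated x y) : T.CausallyRelated (Φ x) (Φ y) :=
  h.imp (Relation.ReflTransGen.lift Φ (fun _ _ ↦ hΦ.causalStep_map) _ _)
    (Relation.ReflTransGen.lift Φ (fun _ _ ↦ hΦ.causalStep_map) _ _)

/-! ### Skies, smooth maps and the contact distribution under the map of light rays. -/

variable {ι : S.LightRay → T.LightRay}

/-- For the inclusion of the right side, every null direction at `Φ x` must come from one at `x`:
the differential is onto and reflects future-directed null vectors. -/
theorem image_sky (hΦ : IsConformalOpenEmbedding S T Φ)
    (hι : ∀ v : S.nullCone,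
      ι (S.ray v) = T.ray ⟨tangentMap (𝓡 d) (𝓡 d) Φ v.1, hΦ.mem_nullCone v⟩) (x : X) :
    ι '' S.sky x = T.sky (Φ x) := by
  ext ℓ
  constructor
  · rintro ⟨_, ⟨v, rfl, rfl⟩, rfl⟩
    exact ⟨_, rfl, (hι v).symm⟩
  · rintro ⟨⟨⟨y, w⟩, hw⟩, hy, rfl⟩
    obtain rfl : y = Φ x := hy
    obtain ⟨v, rfl⟩ := hΦ.mfderiv_surjective x w
    exact ⟨S.ray ⟨⟨x, v⟩, hΦ.mem_nullCone_of_map hw⟩, ⟨_, rfl, rfl⟩, hι _⟩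

section Maps

variable {F : Type*} [NormedAddCommGroup F] [NormedSpace ℝ F] {H : Type*} [TopologicalSpace H]
  {J : ModelWithCorners ℝ F H} {M : Type*} [TopologicalSpace M] [ChartedSpace H M]

/-- Smoothness and contact tangency are both read off from lifts, so transporting lifts by `dΦ`
transports both. -/
theorem isLiftOn_map (hΦ : IsConformalOpenEmbedding S T Φ)
    (hι : ∀ v : S.nullCone,
      ι (S.ray v) = T.ray ⟨tangentMap (𝓡 d) (𝓡 d) Φ v.1, hΦ.mem_nullCone v⟩)
    {f : M → S.LightRay} {L : M → TangentBundle (𝓡 d) X} {U : Set M} (h : S.IsLiftOn J f L U) :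
    T.IsLiftOn J (ι ∘ f) (tangentMap (𝓡 d) (𝓡 d) Φ ∘ L) U := by
  refine ⟨(hΦ.smooth.contMDiff_tangentMap (m := ∞) (by simp)).comp_contMDiffOn h.1,
    fun q hq ↦ ?_⟩
  obtain ⟨hL, hf⟩ := h.2 q hq
  exact ⟨hΦ.mem_nullCone ⟨L q, hL⟩, (hι ⟨L q, hL⟩).symm.trans (congrArg ι hf)⟩

theorem smoothMapOn_map (hΦ : IsConformalOpenEmbedding S T Φ)
    (hι : ∀ v : S.nullCone,
      ι (S.ray v) = T.ray ⟨tangentMap (𝓡 d) (𝓡 d) Φ v.1, hΦ.mem_nullCone v⟩)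
    {f : M → S.LightRay} {s : Set M} (h : S.SmoothMapOn J f s) :
    T.SmoothMapOn J (ι ∘ f) s := by
  intro p hp
  obtain ⟨U, hU, L, hL⟩ := h p hp
  exact ⟨U, hU, _, hΦ.isLiftOn_map hι hL⟩

/-- Along the transported lift, the canonical form is `Ω` times the original one, so it vanishes on
the same vectors. -/
theorem tangentToContactAt_map (hΦ : IsConformalOpenEmbedding S T Φ)
    (hι : ∀ v : S.nullCone,
      ι (S.ray v) = T.ray ⟨tangentMap (𝓡 d) (𝓡 d) Φ v.1, hΦ.mem_nullCone v⟩)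
    {f : M → S.LightRay} {p : M} (h : S.TangentToContactAt J f p) :
    T.TangentToContactAt J (ι ∘ f) p := by
  obtain ⟨U, hU, L, hL, hc⟩ := h
  refine ⟨U, hU, _, hΦ.isLiftOn_map hι hL, fun ξ ↦ ?_⟩
  obtain ⟨Ω, -, -, hΩ⟩ := hΦ.conformal
  have hd : MDifferentiableAt J (𝓡 d) (fun q ↦ (L q).1) p :=
    ((Bundle.contMDiff_proj (TangentSpace (𝓡 d) : X → Type _)).contMDiffAt.comp p
      (hL.1.contMDiffAt hU)).mdifferentiableAt (n := ∞) (by simp)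
  have hcomp : mfderiv J (𝓡 d) (fun q ↦ ((tangentMap (𝓡 d) (𝓡 d) Φ ∘ L) q).1) p
      = (mfderiv (𝓡 d) (𝓡 d) Φ (L p).1).comp (mfderiv J (𝓡 d) (fun q ↦ (L q).1) p) :=
    mfderiv_comp p (hΦ.mdifferentiable (L p).1) hd
  rw [hcomp]
  exact (hΩ (L p).1 (L p).2 _).trans (mul_eq_zero_of_right _ (hc ξ))

end Maps

end IsConformalOpenEmbedding

theorem IsOpenContactEmbedding.immersiveAt_map {F : Type*} [NormedAddCommGroup F]
    [NormedSpace ℝ F] {H : Type*} [TopologicalSpace H] {J : ModelWithCorners ℝ F H}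
    {M : Type*} [TopologicalSpace M] [ChartedSpace H M] {ι : S.LightRay → T.LightRay}
    (hι : IsOpenContactEmbedding S T ι) {f : M → S.LightRay} {p : M}
    (h : S.ImmersiveAt J f p) : T.ImmersiveAt J (ι ∘ f) p := by
  intro ξ hξ
  obtain ⟨W, k, hW, hp, hk, hne⟩ := h ξ hξ
  -- The detecting function is moved to the target by `ι`; its value `0` off the range of `ι` is
  -- immaterial, since smoothness is only required on the open set `ι '' W`.
  have hext : Function.extend ι k 0 ∘ ι = k :=
    Function.extend_comp hι.isOpenEmbedding.injective k 0
  refine ⟨ι '' W, Function.extend ι k 0, hι.isOpenEmbedding.isOpenMap W hW,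
    mem_image_of_mem ι hp, (hι.smooth_iff W _ hW).2 (by rwa [hext]), ?_⟩
  have hcomp : Function.extend ι k 0 ∘ (ι ∘ f) = k ∘ f := by
    rw [← Function.comp_assoc, hext]
  -- The differentials are valued in `ℝ`, read as tangent spaces at equal points.
  have hval : ∀ g : M → ℝ, g = k ∘ f → (mfderiv J 𝓘(ℝ, ℝ) g p ξ : ℝ) ≠ 0 := by
    rintro g rfl
    exact hne
  exact hval _ hcomp

end Pushforward

section Legendrian

variable {n : ℕ} {X : Type*} [TopologicalSpace X]
  [ChartedSpace (EuclideanSpace ℝ (Fin (n + 2))) X] [IsManifold (𝓡 (n + 2)) ∞ X]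
  {Y : Type*} [TopologicalSpace Y]
  [ChartedSpace (EuclideanSpace ℝ (Fin (n + 2))) Y] [IsManifold (𝓡 (n + 2)) ∞ Y]
  {S : Spacetime (n + 2) X} {T : Spacetime (n + 2) Y} {Φ : X → Y}
  {ι : S.LightRay → T.LightRay}

/-- Smoothness and tangency pass through lifts, immersivity through smooth functions on the image of
`ι`, and the embedding property through the topology of `ι`. -/
theorem IsConformalOpenEmbedding.isLegendrianEmbedding_map
    (hΦ : IsConformalOpenEmbedding S T Φ)
    (hι : ∀ v : S.nullCone,
      ι (S.ray v) = T.ray ⟨tangentMap (𝓡 (n + 2)) (𝓡 (n + 2)) Φ v.1, hΦ.mem_nullCone v⟩)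
    (hι' : IsOpenContactEmbedding S T ι) {f : StdSphere n → S.LightRay}
    (hf : S.IsLegendrianEmbedding f) : T.IsLegendrianEmbedding (ι ∘ f) where
  smooth := hΦ.smoothMapOn_map hι hf.smooth
  immersive p := hι'.immersiveAt_map (hf.immersive p)
  isEmbedding := hι'.isOpenEmbedding.isEmbedding.comp hf.isEmbedding
  tangent p := hΦ.tangentToContactAt_map hι (hf.tangent p)

/-- The map of light rays induced by a conformal embedding preserves Legendrian isotopies. -/
theorem IsConformalOpenEmbedding.legendrianIsotopic_map
    (hΦ : IsConformalOpenEmbedding S T Φ)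
    (hι : ∀ v : S.nullCone,
      ι (S.ray v) = T.ray ⟨tangentMap (𝓡 (n + 2)) (𝓡 (n + 2)) Φ v.1, hΦ.mem_nullCone v⟩)
    (hι' : IsOpenContactEmbedding S T ι) {A₀ B₀ A₁ B₁ : Set S.LightRay}
    (h : S.LegendrianIsotopic A₀ B₀ A₁ B₁) :
    T.LegendrianIsotopic (ι '' A₀) (ι '' B₀) (ι '' A₁) (ι '' B₁) := by
  obtain ⟨f, g, hf, hg, hfg, rfl, rfl, rfl, rfl⟩ := h
  refine ⟨fun t ↦ ι ∘ f t, fun t ↦ ι ∘ g t, hΦ.smoothMapOn_map hι hf, hΦ.smoothMapOn_map hι hg,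
    fun t ht ↦ ?_, range_comp _ _, range_comp _ _, range_comp _ _, range_comp _ _⟩
  obtain ⟨h1, h2, h3⟩ := hfg t ht
  refine ⟨hΦ.isLegendrianEmbedding_map hι hι' h1, hΦ.isLegendrianEmbedding_map hι hι' h2, ?_⟩
  rw [range_comp, range_comp]
  exact disjoint_image_of_injective hι'.isOpenEmbedding.injective h3

end Legendrian

theorem mainTheorem3 (n : ℕ) (hn : 1 ≤ n)
    {X : Type*} [TopologicalSpace X] [T2Space X] [SecondCountableTopology X]
    [ChartedSpace (EuclideanSpace ℝ (Fin (n + 2))) X] [IsManifold (𝓡 (n + 2)) ∞ X]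
    {Y : Type*} [TopologicalSpace Y] [T2Space Y] [SecondCountableTopology Y]
    [ChartedSpace (EuclideanSpace ℝ (Fin (n + 2))) Y] [IsManifold (𝓡 (n + 2)) ∞ Y]
    (S : Spacetime (n + 2) X) (T : Spacetime (n + 2) Y)
    (hS : S.IsCausallySimple) (hT : T.IsGloballyHyperbolic)
    (Φ : X → Y) (hΦ : IsConformalOpenEmbedding S T Φ) (hrays : IsOpenContactSubmanifold hΦ)
    (h₁ : ∀ p q : Y, T.CausallyRelated p q → ¬ T.IsotopicToUnlink (T.sky p) (T.sky q))
    (h₂ : ∀ x y : X, ¬ S.CausallyRelated x y → ¬ T.CausallyRelated (Φ x) (Φ y)) :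
    (¬ ∃ S' : Spacetime (n + 2) X, S'.IsCausallySimple ∧ S'.IsRefocussing) →
    ∀ x y x' y' : X, S.CausallyRelated x y → Disjoint (S.sky x) (S.sky y) →
      ¬ S.CausallyRelated x' y' →
      ¬ S.LegendrianIsotopic (S.sky x) (S.sky y) (S.sky x') (S.sky y') := by
  intro _ x y x' y' hxy _ hxy' hiso
  obtain ⟨ι, hι, hι'⟩ := hrays
  -- The unlink that contradicts `h₁` is formed by the skies of `Φ x'` and `Φ y'`.
  refine h₁ (Φ x) (Φ y) (hΦ.causallyRelated_map hxy) ⟨Φ x', Φ y', h₂ x' y' hxy', ?_⟩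
  have h := hΦ.legendrianIsotopic_map hι hι' hiso
  simpa only [hΦ.image_sky hι] using h
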